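/- Let $(\Omega,\mathcal A,m)$ be a measure space and let $1<p,q<\infty$. Suppose that for every $\alpha\in\mathcal A$ there are real-valued $\mu^\alpha\in L^p(\Omega)$ and $\nu^\alpha\in L^q(\Omega)$ with $$\mu^\alpha\le 0 \ \text{ a.e. on } \Omega\setminus\alpha, \qquad \nu^\alpha\le 0 \ \text{ a.e. on } \alpha .$$ Suppose furthermore that there are a measurable function $c_0:\Omega\to\mathbb R$ and a constant $c_1>0$ such that for all $\alpha\in\mathcal A$ $$\max(\mu^\alpha,\nu^\alpha)\le c_0 \ \text{ a.e. on } \Omega, \qquad \|\mu^\alpha\|_{L^p(\Omega)}+\|\nu^\alpha\|_{L^q(\Omega)}\le c_1 .$$ Then there exists a point $(\bar\mu,\bar\nu)$ in the closed convex hull of $\{(\mu^\alpha,\nu^\alpha) : \alpha\in\mathcal A\}$ in $L^p(\Omega)\times L^q(\Omega)$ such that $$(\bar\mu<0\ \wedge\ \bar\nu<0)\ \vee\ \bar\mu\,\bar\nu=0 \qquad \text{a.e. on } \Omega .$$ -/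

import Mathlib

open MeasureTheory
open scoped ENNReal

/-!
For a measurable set `α` let `C α` be the convex set of pairs that are nonpositive in the first
component off `α` and in the second component on `α` (`signSet`). The convex hull `K₀` of the data
meets every `C α`.

The idea is extremal. Suppose `D ⊆ K₀` is convex, meets every `C α`, and `C α ∩ D` has very small
diameter for one `α`. Take `x` in it. Let `P ⊆ α` be the set where `x.2 < -δ` and `c₀ ≤ M`, and
choose `y` in `C (α \ P) ∩ D`. A step of fixed length from `x` towards `y` does not leave `C α`,
since the slack `δ` of `x.2` on `P` pays for the bound `M` on `y.2`
(`smul_add_smul_mem_signSet`). So `y` is close to `x`. But `y.1 ≤ 0` on `P`, so `x.1` is hardly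
positive there. In the same way, `x.2` is hardly positive where `x.1 < -δ` off `α`. In the limit of
such `x`, neither component can be positive where the other one is nonzero
(`complementary_of_tendsto`).

It remains to find such `D` and `α` with points `x` that converge in norm (`exists_seq_shrinking`).
Let `Ψ x = ‖x.1‖ ^ p + ‖x.2‖ ^ q`, which is uniformly convex on bounded sets
(`exists_norm_sub_le_of_midpoint_gap_Lp`), and let `R` be the supremum over `α` of the infimum of
`Ψ` on `C α ∩ K₀`. The sublevel set of `Ψ` at a level just above `R` meets every `C α`. If `α` nearly
attains the supremum, then `Ψ` is nearly constant on the part of `C α` in this sublevel set, so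
uniform convexity makes that part small. Repeating this with `Ψ` plus a suitable linear functional,
which Hahn–Banach provides (`exists_affine_minorant_of_le_on`), yields smaller sets close to the
previous ones, hence a Cauchy sequence. No weak compactness and no fixed point theorem is needed.
-/

open Filter Topology

/-! ### The midpoint gap of the `p`-th power on the real line -/

theorem abs_midpoint_rpow_lt {p : ℝ} (hp : 1 < p) {s r : ℝ} (h : s ≠ r) :
    |(s + r) / 2| ^ p < |s| ^ p / 2 + |r| ^ p / 2 := by
  have hp0 : 0 < p := by linarith
  rcases eq_or_ne |s| |r| with hsr | hsr
  · have hs : s = -r := (abs_eq_abs.1 hsr).resolve_left h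
    have hr : r ≠ 0 := by rintro rfl; simp at hs; exact h hs
    have : 0 < |r| ^ p := Real.rpow_pos_of_pos (abs_pos.2 hr) p
    subst hs
    simpa [Real.zero_rpow hp0.ne'] using this
  · have h1 := (strictConvexOn_rpow hp).2 (Set.mem_Ici.2 (abs_nonneg s))
      (Set.mem_Ici.2 (abs_nonneg r)) hsr (by norm_num : (0 : ℝ) < 1 / 2)
      (by norm_num : (0 : ℝ) < 1 / 2) (by norm_num)
    simp only [smul_eq_mul] at h1
    have h2 : |(s + r) / 2| ≤ 1 / 2 * |s| + 1 / 2 * |r| := by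
      rw [abs_div, abs_two]
      linarith [abs_add_le s r]
    have h3 := Real.rpow_le_rpow (abs_nonneg _) h2 hp0.le
    linarith

theorem abs_midpoint_rpow_le {p : ℝ} (hp : 1 < p) (s r : ℝ) :
    |(s + r) / 2| ^ p ≤ |s| ^ p / 2 + |r| ^ p / 2 := by
  rcases eq_or_ne s r with rfl | h
  · simp
  · exact (abs_midpoint_rpow_lt hp h).le

/-- The midpoint gap of `|·| ^ p` controls `|s - r| ^ p`, up to an arbitrarily small multiple of
`|s| ^ p + |r| ^ p`. Both sides are homogeneous of degree `p`, so it suffices to look at the unit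
sphere of `ℝ × ℝ`, where the gap is bounded below on the compact set of pairs for which the term
with `ε` alone does not suffice. This covers all `p > 1` at once. -/
theorem exists_abs_sub_rpow_le {p : ℝ} (hp : 1 < p) {ε : ℝ} (hε : 0 < ε) :
    ∃ C : ℝ, 0 ≤ C ∧ ∀ s r : ℝ, |s - r| ^ p ≤
      ε * (|s| ^ p + |r| ^ p) + C * (|s| ^ p / 2 + |r| ^ p / 2 - |(s + r) / 2| ^ p) := by
  have hp0 : 0 < p := by linarith
  have hc : ∀ f : ℝ × ℝ → ℝ, Continuous f → Continuous fun z => |f z| ^ p := fun f hf =>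
    (hf.abs).rpow_const fun _ => Or.inr hp0.le
  have c1 := hc (fun z => z.1 - z.2) (by fun_prop)
  have c2 := hc (fun z => z.1) (by fun_prop)
  have c3 := hc (fun z => z.2) (by fun_prop)
  have c4 := hc (fun z => (z.1 + z.2) / 2) (by fun_prop)
  let g : ℝ × ℝ → ℝ := fun z => |z.1| ^ p / 2 + |z.2| ^ p / 2 - |(z.1 + z.2) / 2| ^ p
  have hg : Continuous g := ((c2.div_const 2).add (c3.div_const 2)).sub c4
  let T : Set (ℝ × ℝ) := Metric.sphere 0 1 ∩
    {z | ε * (|z.1| ^ p + |z.2| ^ p) ≤ |z.1 - z.2| ^ p}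
  have hT : IsCompact T := (isCompact_sphere _ _).inter_right
    (isClosed_le (continuous_const.mul (c2.add c3)) c1)
  have hpos : ∀ z ∈ T, 0 < g z := by
    rintro ⟨s, r⟩ ⟨hz, hle⟩
    have : s ≠ r := by
      rintro rfl
      simp only [Set.mem_ofPred_eq, sub_self, abs_zero, Real.zero_rpow hp0.ne'] at hle
      have hs : |s| ^ p ≤ 0 := by nlinarith
      have h0 : |s| = 0 := by
        by_contra hne
        exact absurd (Real.rpow_pos_of_pos (lt_of_le_of_ne (abs_nonneg s) (Ne.symm hne)) p)
          (not_lt.2 hs)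
      have : s = 0 := abs_eq_zero.1 h0
      subst this
      simp [Prod.norm_def] at hz
    have := abs_midpoint_rpow_lt hp this
    simp only [g]; linarith
  obtain ⟨κ, hκ, hκT⟩ : ∃ κ > 0, ∀ z ∈ T, κ ≤ g z := by
    rcases T.eq_empty_or_nonempty with h | h
    · exact ⟨1, one_pos, by simp [h]⟩
    · obtain ⟨z, hz, hmin⟩ := hT.exists_isMinOn h hg.continuousOn
      exact ⟨g z, hpos z hz, fun w hw => hmin hw⟩
  refine ⟨2 ^ p / κ, by positivity, fun s r => ?_⟩
  -- off `T` the term with `ε` suffices; on `T` use `|z.1 - z.2| ≤ 2` and the lower bound `κ`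
  have key : ∀ z ∈ Metric.sphere (0 : ℝ × ℝ) 1,
      |z.1 - z.2| ^ p ≤ ε * (|z.1| ^ p + |z.2| ^ p) + 2 ^ p / κ * g z := by
    intro z hz
    have hg0 : 0 ≤ g z := by have := abs_midpoint_rpow_le hp z.1 z.2; simp only [g]; linarith
    by_cases hzT : z ∈ T
    · have h1 : |z.1 - z.2| ≤ 2 := by
        have hz' : max |z.1| |z.2| = 1 := by simpa [Prod.norm_def] using hz
        have := abs_sub z.1 z.2
        linarith [le_max_left |z.1| |z.2|, le_max_right |z.1| |z.2|]
      have h2 : |z.1 - z.2| ^ p ≤ 2 ^ p := Real.rpow_le_rpow (abs_nonneg _) h1 hp0.le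
      have h3 : (2 : ℝ) ^ p ≤ 2 ^ p / κ * g z := by
        rw [div_mul_eq_mul_div, le_div_iff₀ hκ]
        exact mul_le_mul_of_nonneg_left (hκT z hzT) (by positivity)
      have : 0 ≤ ε * (|z.1| ^ p + |z.2| ^ p) := by positivity
      linarith
    · have : |z.1 - z.2| ^ p < ε * (|z.1| ^ p + |z.2| ^ p) := by
        by_contra hcon
        exact hzT ⟨hz, not_lt.1 hcon⟩
      have : 0 ≤ 2 ^ p / κ * g z := by positivity
      linarith
  -- both sides are homogeneous of degree `p`
  rcases eq_or_ne ((s, r) : ℝ × ℝ) 0 with h0 | h0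
  · obtain ⟨rfl, rfl⟩ := Prod.mk_eq_zero.1 h0
    simp [Real.zero_rpow hp0.ne']
  · set l := ‖((s, r) : ℝ × ℝ)‖ with hl
    have hlpos : 0 < l := norm_pos_iff.2 h0
    have hz : ((s / l, r / l) : ℝ × ℝ) ∈ Metric.sphere (0 : ℝ × ℝ) 1 := by
      have : ((s / l, r / l) : ℝ × ℝ) = l⁻¹ • (s, r) := by
        simp [div_eq_inv_mul]
      rw [mem_sphere_zero_iff_norm, this, norm_smul, ← hl, norm_inv, norm_norm,
        inv_mul_cancel₀ hlpos.ne']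
    have h := key _ hz
    have hdiv : ∀ a : ℝ, |a / l| ^ p = |a| ^ p / l ^ p := fun a => by
      rw [abs_div, abs_of_pos hlpos, Real.div_rpow (abs_nonneg _) hlpos.le]
    have hlp : 0 < l ^ p := Real.rpow_pos_of_pos hlpos p
    have e1 : s / l - r / l = (s - r) / l := by ring
    have e2 : (s / l + r / l) / 2 = ((s + r) / 2) / l := by ring
    simp only [g, e1, e2, hdiv] at h
    have h' := mul_le_mul_of_nonneg_right h hlp.le
    have e3 : |s - r| ^ p / l ^ p * l ^ p = |s - r| ^ p := div_mul_cancel₀ _ hlp.ne'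
    rw [e3] at h'
    refine h'.trans (le_of_eq ?_)
    field_simp

/-! ### Uniform convexity of the `p`-th power of the norm on `Lp` -/

section

variable {Ω : Type*} [MeasurableSpace Ω] {m : Measure Ω}

theorem one_lt_toReal_of_lt_top {p : ℝ≥0∞} (hp : 1 < p) (hp' : p < ∞) : 1 < p.toReal := by
  rw [← ENNReal.toReal_one]
  exact (ENNReal.toReal_lt_toReal (by simp) hp'.ne).2 hp

theorem integrable_abs_rpow_Lp {p : ℝ≥0∞} [Fact (1 ≤ p)] (hp' : p < ∞) (f : Lp ℝ p m) :
    Integrable (fun ω => |f ω| ^ p.toReal) m := by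
  have := (Lp.memLp f).integrable_norm_rpow (zero_lt_one.trans_le Fact.out).ne' hp'.ne
  simpa using this

theorem norm_rpow_eq_integral_Lp {p : ℝ≥0∞} [Fact (1 ≤ p)] (hp' : p < ∞) (f : Lp ℝ p m) :
    ‖f‖ ^ p.toReal = ∫ ω, |f ω| ^ p.toReal ∂m := by
  have h0 : p ≠ 0 := (zero_lt_one.trans_le Fact.out).ne'
  have hp0 : 0 < p.toReal := ENNReal.toReal_pos h0 hp'.ne
  have hI : 0 ≤ ∫ ω, ‖f ω‖ ^ p.toReal ∂m := integral_nonneg fun _ => by positivity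
  rw [Lp.norm_def, (Lp.memLp f).eLpNorm_eq_integral_rpow_norm h0 hp'.ne,
    ENNReal.toReal_ofReal (by positivity), ← Real.rpow_mul hI, inv_mul_cancel₀ hp0.ne',
    Real.rpow_one]
  simp

theorem coeFn_midpoint_Lp {p : ℝ≥0∞} (f g : Lp ℝ p m) :
    ((1 / 2 : ℝ) • (f + g) : Lp ℝ p m) =ᵐ[m] fun ω => (f ω + g ω) / 2 := by
  filter_upwards [Lp.coeFn_smul (1 / 2 : ℝ) (f + g), Lp.coeFn_add f g] with ω h1 h2
  rw [h1, Pi.smul_apply, h2, Pi.add_apply, smul_eq_mul]; ring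

theorem norm_midpoint_rpow_le_Lp {p : ℝ≥0∞} [Fact (1 ≤ p)] (hp : 1 < p) (hp' : p < ∞)
    (f g : Lp ℝ p m) :
    ‖(1 / 2 : ℝ) • (f + g)‖ ^ p.toReal ≤ ‖f‖ ^ p.toReal / 2 + ‖g‖ ^ p.toReal / 2 := by
  have hp1 : 1 < p.toReal := one_lt_toReal_of_lt_top hp hp'
  have hf := integrable_abs_rpow_Lp hp' f
  have hg := integrable_abs_rpow_Lp hp' g
  rw [norm_rpow_eq_integral_Lp hp', norm_rpow_eq_integral_Lp hp', norm_rpow_eq_integral_Lp hp',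
    ← integral_div, ← integral_div, ← integral_add (hf.div_const 2) (hg.div_const 2)]
  refine integral_mono_ae (integrable_abs_rpow_Lp hp' _)
    ((hf.div_const 2).add (hg.div_const 2)) ?_
  filter_upwards [coeFn_midpoint_Lp f g] with ω h
  simp only [h]
  exact abs_midpoint_rpow_le hp1 _ _

/-- Uniform convexity of `‖·‖ ^ p` on bounded subsets of `Lp`, for `1 < p < ∞`. -/
theorem exists_norm_sub_le_of_midpoint_gap_Lp {p : ℝ≥0∞} [Fact (1 ≤ p)] (hp : 1 < p)
    (hp' : p < ∞) (c : ℝ) {θ : ℝ} (hθ : 0 < θ) :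
    ∃ η > 0, ∀ f g : Lp ℝ p m, ‖f‖ ≤ c → ‖g‖ ≤ c →
      ‖f‖ ^ p.toReal / 2 + ‖g‖ ^ p.toReal / 2 - ‖(1 / 2 : ℝ) • (f + g)‖ ^ p.toReal ≤ η →
      ‖f - g‖ ≤ θ := by
  have hp1 : 1 < p.toReal := one_lt_toReal_of_lt_top hp hp'
  set r := p.toReal with hr
  have hr0 : 0 < r := by linarith
  have hD : 0 ≤ |c| ^ r := by positivity
  have hθr : 0 < θ ^ r := Real.rpow_pos_of_pos hθ r
  set ε := θ ^ r / (4 * (|c| ^ r + 1)) with hε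
  obtain ⟨C, hC, hineq⟩ := exists_abs_sub_rpow_le hp1 (ε := ε) (by positivity)
  refine ⟨θ ^ r / (2 * (C + 1)), by positivity, fun f g hf hg hgap => ?_⟩
  have If := integrable_abs_rpow_Lp hp' f
  have Ig := integrable_abs_rpow_Lp hp' g
  have Im := integrable_abs_rpow_Lp hp' ((1 / 2 : ℝ) • (f + g))
  -- integrate the pointwise inequality `hineq`
  have key : ‖f - g‖ ^ r ≤ ε * (‖f‖ ^ r + ‖g‖ ^ r) +
      C * (‖f‖ ^ r / 2 + ‖g‖ ^ r / 2 - ‖(1 / 2 : ℝ) • (f + g)‖ ^ r) := by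
    have I1 : Integrable (fun ω => ε * (|f ω| ^ r + |g ω| ^ r)) m := (If.add Ig).const_mul ε
    have I2 : Integrable (fun ω => |f ω| ^ r / 2 + |g ω| ^ r / 2) m :=
      (If.div_const 2).add (Ig.div_const 2)
    have I3 : Integrable (fun ω => C * (|f ω| ^ r / 2 + |g ω| ^ r / 2 -
      |((1 / 2 : ℝ) • (f + g) : Lp ℝ p m) ω| ^ r)) m := (I2.sub Im).const_mul C
    have hrhs : ε * (‖f‖ ^ r + ‖g‖ ^ r) +
        C * (‖f‖ ^ r / 2 + ‖g‖ ^ r / 2 - ‖(1 / 2 : ℝ) • (f + g)‖ ^ r) =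
        ∫ ω, (ε * (|f ω| ^ r + |g ω| ^ r) + C * (|f ω| ^ r / 2 + |g ω| ^ r / 2 -
          |((1 / 2 : ℝ) • (f + g) : Lp ℝ p m) ω| ^ r)) ∂m := by
      rw [integral_add I1 I3, integral_const_mul, integral_const_mul, integral_sub I2 Im,
        integral_add If Ig, integral_add (If.div_const 2) (Ig.div_const 2), integral_div,
        integral_div]
      simp only [hr, norm_rpow_eq_integral_Lp hp']
    rw [hrhs, hr, norm_rpow_eq_integral_Lp hp']
    refine integral_mono_ae (integrable_abs_rpow_Lp hp' _) (I1.add I3) ?_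
    filter_upwards [coeFn_midpoint_Lp f g, Lp.coeFn_sub f g] with ω h1 h2
    simp only [h1, h2, Pi.sub_apply]
    exact hineq _ _
  have b : ∀ h : Lp ℝ p m, ‖h‖ ≤ c → ‖h‖ ^ r ≤ |c| ^ r := fun h hh =>
    Real.rpow_le_rpow (norm_nonneg _) (hh.trans (le_abs_self c)) hr0.le
  have h1 : ε * (‖f‖ ^ r + ‖g‖ ^ r) ≤ θ ^ r / 2 := by
    calc ε * (‖f‖ ^ r + ‖g‖ ^ r) ≤ ε * (2 * (|c| ^ r + 1)) :=
          mul_le_mul_of_nonneg_left (by linarith [b f hf, b g hg]) (by positivity)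
      _ = θ ^ r / 2 := by rw [hε]; field_simp; norm_num
  have h2 : C * (‖f‖ ^ r / 2 + ‖g‖ ^ r / 2 - ‖(1 / 2 : ℝ) • (f + g)‖ ^ r) ≤ θ ^ r / 2 := by
    calc _ ≤ C * (θ ^ r / (2 * (C + 1))) := mul_le_mul_of_nonneg_left hgap hC
      _ ≤ (C + 1) * (θ ^ r / (2 * (C + 1))) :=
          mul_le_mul_of_nonneg_right (by linarith) (by positivity)
      _ = θ ^ r / 2 := by field_simp
  exact (Real.rpow_le_rpow_iff (norm_nonneg _) hθ.le hr0).1 (by linarith)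

end

/-! ### Convex sets that meet every member of a family -/

/-- If a continuous convex function `F` is at least `a` on a convex set `S`, then an affine
function that is at least `a` on `S` is a minorant of `F`. This is Hahn–Banach in `E × ℝ`, applied
to the strict epigraph of `F` and `S ×ˢ Iic a`. -/
theorem exists_affine_minorant_of_le_on {E : Type*} [NormedAddCommGroup E] [NormedSpace ℝ E]
    {F : E → ℝ} (hF : ConvexOn ℝ Set.univ F) (hFc : Continuous F) {S : Set E}
    (hS : Convex ℝ S) (hne : S.Nonempty) {a : ℝ} (ha : ∀ x ∈ S, a ≤ F x) :
    ∃ (ℓ : E →L[ℝ] ℝ) (s : ℝ), (∀ y, a + (ℓ y - s) ≤ F y) ∧ ∀ y ∈ S, s ≤ ℓ y := by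
  have hopen : IsOpen {z : E × ℝ | F z.1 < z.2} :=
    isOpen_lt (hFc.comp continuous_fst) continuous_snd
  have hconv : Convex ℝ {z : E × ℝ | F z.1 < z.2} := by
    simpa using hF.convex_strict_epigraph
  have hdisj : Disjoint {z : E × ℝ | F z.1 < z.2} (S ×ˢ Set.Iic a) := by
    rw [Set.disjoint_left]
    rintro ⟨y, r⟩ h ⟨h1, h2⟩
    exact absurd (ha y h1) (not_le.2 (lt_of_lt_of_le h h2))
  obtain ⟨Φ, u, h1, h2⟩ := geometric_hahn_banach_open hconv hopen (hS.prod (convex_Iic a)) hdisj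
  set κ : ℝ := Φ (0, 1) with hκ
  have hdec : ∀ (y : E) (r : ℝ), Φ (y, r) = Φ (y, 0) + r * κ := fun y r => by
    have : ((y, r) : E × ℝ) = (y, 0) + r • (0, 1) := by simp
    rw [this, map_add, map_smul, smul_eq_mul]
  obtain ⟨y₀, hy₀⟩ := hne
  -- the separating functional is not vertical, because the epigraph is unbounded upwards
  have hκneg : κ < 0 := by
    have e1 := h1 (y₀, F y₀ + 1) (lt_add_one (F y₀))
    have e2 := h2 (y₀, a) ⟨hy₀, Set.mem_Iic.2 le_rfl⟩
    rw [hdec] at e1 e2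
    nlinarith [ha y₀ hy₀]
  obtain ⟨c, hc, hcκ⟩ : ∃ c : ℝ, 0 < c ∧ c * κ = -1 :=
    ⟨-κ⁻¹, neg_pos.2 (inv_lt_zero.2 hκneg), by rw [neg_mul, inv_mul_cancel₀ hκneg.ne]⟩
  have hle : ∀ y, Φ (y, 0) + F y * κ ≤ u := fun y => by
    refine le_of_forall_pos_lt_add fun ε hε => ?_
    have e := h1 (y, F y + ε * c) (lt_add_of_pos_right (F y) (mul_pos hε hc))
    rw [hdec] at e
    linear_combination e - ε * hcκ
  refine ⟨c • Φ.comp (ContinuousLinearMap.inl ℝ E ℝ), c * u + a, fun y => ?_, fun y hy => ?_⟩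
  · have e := mul_le_mul_of_nonneg_left (hle y) hc.le
    show a + (c * Φ (y, 0) - (c * u + a)) ≤ F y
    linear_combination e - F y * hcκ
  · have e2 := h2 (y, a) ⟨hy, Set.mem_Iic.2 le_rfl⟩
    rw [hdec] at e2
    have e := mul_le_mul_of_nonneg_left e2 hc.le
    show c * u + a ≤ c * Φ (y, 0)
    linear_combination e + a * hcκ

/-- An index whose infimum of `F` over `C i ∩ K` is within `ε` of the supremum of these infima
over all indices. -/
theorem exists_approx_maximin {E I : Type*} [Nonempty I] {K : Set E} {C : I → Set E} {F : E → ℝ}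
    (hne : ∀ i, (C i ∩ K).Nonempty) {b : ℝ} (hb : ∀ x ∈ K, |F x| ≤ b) {ε : ℝ} (hε : 0 < ε) :
    ∃ (i : I) (a : ℝ), (∀ x ∈ C i ∩ K, a ≤ F x) ∧ ∀ i', ∃ x ∈ C i' ∩ K, F x ≤ a + ε := by
  let A : Set ℝ := {a | ∃ i, ∀ x ∈ C i ∩ K, a ≤ F x}
  have hA : A.Nonempty :=
    ⟨-b, Classical.arbitrary I, fun x hx => (abs_le.1 (hb x hx.2)).1⟩
  have hAb : BddAbove A := by
    refine ⟨b, ?_⟩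
    rintro a ⟨i, hi⟩
    obtain ⟨x, hx⟩ := hne i
    exact (hi x hx).trans (abs_le.1 (hb x hx.2)).2
  obtain ⟨a, ⟨i, hi⟩, hlt⟩ := exists_lt_of_lt_csSup hA (sub_lt_self (sSup A) hε)
  refine ⟨i, a, hi, fun i' => ?_⟩
  by_contra! hcon
  have : a + ε ≤ sSup A := le_csSup hAb ⟨i', fun x hx => (hcon x hx).le⟩
  linarith

/-- For `F = Ψ + L`: an index that nearly maximizes the infimum of `F` over `C i ∩ K`, a value
`lower` for this infimum that is correct up to `ε`, and an affine minorant
`lower + (slope - level)` of `F` that is at least `lower` on `C index ∩ {x ∈ K | F x ≤ lower + ε}`.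
By `exists_le`, the sublevel set `{x ∈ K | F x ≤ lower + ε}` still meets every `C i`. -/
structure ExposingData {E I : Type*} [NormedAddCommGroup E] [NormedSpace ℝ E]
    (C : I → Set E) (Ψ : E → ℝ) (ε : ℝ) (K : Set E) (L : E →L[ℝ] ℝ) where
  index : I
  lower : ℝ
  slope : E →L[ℝ] ℝ
  level : ℝ
  le_of_mem : ∀ x ∈ C index ∩ K, lower ≤ Ψ x + L x
  exists_le : ∀ i, ∃ x ∈ C i ∩ K, Ψ x + L x ≤ lower + ε
  minorant : ∀ y, lower + (slope y - level) ≤ Ψ y + L y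
  level_le : ∀ y ∈ C index ∩ {x ∈ K | Ψ x + L x ≤ lower + ε}, level ≤ slope y

theorem nonempty_exposingData {E I : Type*} [NormedAddCommGroup E] [NormedSpace ℝ E] [Nonempty I]
    {C : I → Set E} (hC : ∀ i, Convex ℝ (C i)) {Ψ : E → ℝ} (hΨ : ConvexOn ℝ Set.univ Ψ)
    (hΨc : Continuous Ψ) {ε : ℝ} (hε : 0 < ε) {K : Set E} (hK : Convex ℝ K)
    (hne : ∀ i, (C i ∩ K).Nonempty) {b R : ℝ} (hR : ∀ x ∈ K, ‖x‖ ≤ R) (hb : ∀ x ∈ K, |Ψ x| ≤ b)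
    (L : E →L[ℝ] ℝ) : Nonempty (ExposingData C Ψ ε K L) := by
  have hbd : ∀ x ∈ K, |Ψ x + L x| ≤ b + ‖L‖ * R := fun x hx => by
    refine (abs_add_le _ _).trans (add_le_add (hb x hx) ?_)
    exact (L.le_opNorm x).trans (mul_le_mul_of_nonneg_left (hR x hx) (norm_nonneg L))
  have hF : ConvexOn ℝ Set.univ fun x => Ψ x + L x :=
    hΨ.add (L.toLinearMap.convexOn convex_univ)
  obtain ⟨i, a, h1, h2⟩ := exists_approx_maximin hne hbd hε
  have hK' : Convex ℝ {x ∈ K | Ψ x + L x ≤ a + ε} :=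
    (hF.subset (Set.subset_univ K) hK).convex_le (a + ε)
  have hne' : (C i ∩ {x ∈ K | Ψ x + L x ≤ a + ε}).Nonempty := by
    obtain ⟨x, hx, hle⟩ := h2 i
    exact ⟨x, hx.1, hx.2, hle⟩
  obtain ⟨ℓ, s, h3, h4⟩ := exists_affine_minorant_of_le_on hF (hΨc.add L.continuous)
    ((hC i).inter hK') hne' fun x hx => h1 x ⟨hx.1, hx.2.1⟩
  exact ⟨⟨i, a, ℓ, s, h1, h2, h3, h4⟩⟩

/-- Let a bounded convex set `K₀` meet every member of a family of convex sets `C i`, and let `Ψ`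
be uniformly convex on `K₀`. Then there are convex sets `D n ⊆ K₀`, each of which meets every `C i`,
and indices `i n` such that `C (i n) ∩ D n` has diameter at most `θ n` and is within `θ n` of
`C (i (n + 1)) ∩ D (n + 1)`, in the sense that any two of their points are that close.

Each stage cuts the current set `K` down to a sublevel set of the current function `F = Ψ + L`, at
a level where `F` is nearly constant on `C (i n) ∩ D n`, and adds to `L` the slope of an affine
minorant that touches `F` approximately along this set. The added slope makes the next stage choose
an index whose points are again nearly maximal for both `F` and the slope, hence close to the
previous ones. Adding `L` to `Ψ` leaves the midpoint gap unchanged. -/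
theorem exists_seq_shrinking {E I : Type*} [NormedAddCommGroup E] [NormedSpace ℝ E] [Nonempty I]
    {K₀ : Set E} (hK₀ : Convex ℝ K₀) {C : I → Set E} (hC : ∀ i, Convex ℝ (C i))
    (hne : ∀ i, (C i ∩ K₀).Nonempty) {Ψ : E → ℝ} (hΨ : ConvexOn ℝ Set.univ Ψ)
    (hΨc : Continuous Ψ) {b R : ℝ} (hR : ∀ x ∈ K₀, ‖x‖ ≤ R) (hb : ∀ x ∈ K₀, |Ψ x| ≤ b)
    (huc : ∀ θ > 0, ∃ η > 0, ∀ x ∈ K₀, ∀ y ∈ K₀,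
      Ψ x / 2 + Ψ y / 2 - Ψ ((1 / 2 : ℝ) • (x + y)) ≤ η → ‖x - y‖ ≤ θ)
    {θ : ℕ → ℝ} (hθ : ∀ n, 0 < θ n) :
    ∃ (i : ℕ → I) (D : ℕ → Set E),
      (∀ n, D n ⊆ K₀) ∧ (∀ n, Convex ℝ (D n)) ∧ (∀ n j, (C j ∩ D n).Nonempty) ∧
      (∀ n, ∀ x ∈ C (i n) ∩ D n, ∀ y ∈ C (i n) ∩ D n, ‖x - y‖ ≤ θ n) ∧
      ∀ n, ∀ x ∈ C (i n) ∩ D n, ∀ y ∈ C (i (n + 1)) ∩ D (n + 1), ‖x - y‖ ≤ θ n := by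
  choose η hη hηθ using fun n => huc (θ n) (hθ n)
  obtain ⟨ε, hε, hεη, hεmono⟩ : ∃ ε : ℕ → ℝ, (∀ n, 0 < ε n) ∧ (∀ n, 2 * ε n ≤ η n) ∧
      ∀ n, ε (n + 1) ≤ ε n := by
    let ε : ℕ → ℝ := fun n => Nat.rec (η 0 / 2) (fun k e => min e (η (k + 1) / 2)) n
    refine ⟨ε, fun n => ?_, fun n => ?_, fun n => min_le_left _ _⟩
    · induction n with
      | zero => exact half_pos (hη 0)
      | succ k ih => exact lt_min ih (half_pos (hη (k + 1)))
    · cases n with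
      | zero => exact (mul_div_cancel₀ (η 0) two_ne_zero).le
      | succ k =>
        have : ε (k + 1) ≤ η (k + 1) / 2 := min_le_right _ _
        linarith
  -- a stage: a convex subset of `K₀` that meets every `C i`, and the linear part added to `Ψ`
  let State := {s : Set E × (E →L[ℝ] ℝ) //
    s.1 ⊆ K₀ ∧ Convex ℝ s.1 ∧ ∀ i, (C i ∩ s.1).Nonempty}
  have hex : ∀ (n : ℕ) (s : State), Nonempty (ExposingData C Ψ (ε n) s.1.1 s.1.2) := fun n s =>
    nonempty_exposingData hC hΨ hΨc (hε n) s.2.2.1 s.2.2.2 (fun x hx => hR x (s.2.1 hx))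
      (fun x hx => hb x (s.2.1 hx)) s.1.2
  let d : ∀ (n : ℕ) (s : State), ExposingData C Ψ (ε n) s.1.1 s.1.2 := fun n s =>
    Classical.choice (hex n s)
  let next : ℕ → State → State := fun n s =>
    ⟨({x ∈ s.1.1 | Ψ x + s.1.2 x ≤ (d n s).lower + ε n}, s.1.2 + (d n s).slope),
      fun x hx => s.2.1 hx.1,
      ((hΨ.add (s.1.2.toLinearMap.convexOn convex_univ)).subset (Set.subset_univ _)
        s.2.2.1).convex_le _,
      fun i => by
        obtain ⟨x, hx, hle⟩ := (d n s).exists_le i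
        exact ⟨x, hx.1, hx.2, hle⟩⟩
  let st : ℕ → State := fun n => Nat.rec ⟨(K₀, 0), subset_rfl, hK₀, hne⟩ next n
  have hst : ∀ n, st (n + 1) = next n (st n) := fun n => rfl
  refine ⟨fun n => (d n (st n)).index, fun n => (st (n + 1)).1.1, fun n => (st (n + 1)).2.1,
    fun n => (st (n + 1)).2.2.1, fun n => (st (n + 1)).2.2.2, ?_, ?_⟩
  · rintro n x ⟨hxC, hxD⟩ y ⟨hyC, hyD⟩
    refine hηθ n x ((st (n + 1)).2.1 hxD) y ((st (n + 1)).2.1 hyD) ?_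
    have hs1 := (d n (st n)).level_le x ⟨hxC, hxD⟩
    have hs2 := (d n (st n)).level_le y ⟨hyC, hyD⟩
    -- the minorant at the midpoint bounds the midpoint gap
    have hmin := (d n (st n)).minorant ((1 / 2 : ℝ) • (x + y))
    simp only [map_smul, map_add, smul_eq_mul] at hmin
    have hx2 := hxD.2
    have hy2 := hyD.2
    have := hεη n
    have := hε n
    linarith
  · rintro n x ⟨hxC, hxD⟩ y ⟨hyC, hyD⟩
    have hyD' : y ∈ (st (n + 1)).1.1 := hyD.1
    refine hηθ n x ((st (n + 1)).2.1 hxD) y ((st (n + 1)).2.1 hyD') ?_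
    have hs1 := (d n (st n)).level_le x ⟨hxC, hxD⟩
    have hmin := (d n (st n)).minorant ((1 / 2 : ℝ) • (x + y))
    simp only [map_smul, map_add, smul_eq_mul] at hmin
    have hx2 := hxD.2
    have hy2 := hyD'.2
    -- the previous index competes in the new maximin, which bounds the new value from below and so
    -- forces the slope at `y` to be at least the level, up to `ε n + ε (n + 1)`
    obtain ⟨z, ⟨hzC, hzD⟩, hz⟩ := (d (n + 1) (st (n + 1))).exists_le (d n (st n)).index
    have hs3 := (d n (st n)).level_le z ⟨hzC, hzD⟩
    have hz2 := (d n (st n)).le_of_mem z ⟨hzC, hzD.1⟩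
    have hy3 := (d (n + 1) (st (n + 1))).le_of_mem y ⟨hyC, hyD.1⟩
    have hL : ∀ w, (st (n + 1)).1.2 w = (st n).1.2 w + (d n (st n)).slope w := fun w => rfl
    rw [hL] at hz hy3
    have := hεη n
    have := hε n
    have := hεmono n
    linarith

theorem norm_sub_le_of_mix {E : Type*} [NormedAddCommGroup E] [NormedSpace ℝ E] {x y : E}
    {M δ θ : ℝ} (hM : 0 ≤ M) (hδ : 0 < δ)
    (h : ‖x - ((M / (M + δ)) • x + (δ / (M + δ)) • y)‖ ≤ θ) : ‖x - y‖ ≤ (M + δ) / δ * θ := by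
  have hMδ : 0 < M + δ := by linarith
  have e : x - ((M / (M + δ)) • x + (δ / (M + δ)) • y) = (δ / (M + δ)) • (x - y) := by
    have : M / (M + δ) = 1 - δ / (M + δ) := by field_simp; ring
    rw [this]; module
  rw [e, norm_smul, Real.norm_of_nonneg (by positivity)] at h
  calc ‖x - y‖ = (M + δ) / δ * (δ / (M + δ) * ‖x - y‖) := by field_simp
    _ ≤ _ := mul_le_mul_of_nonneg_left h (by positivity)

/-! ### Sign conditions in `Lp` spaces -/

section

variable {Ω : Type*} [MeasurableSpace Ω] {m : Measure Ω}

/-- The pairs whose first component is nonpositive almost everywhere off `α` and whose second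
component is nonpositive almost everywhere on `α`. -/
def signSet (m : Measure Ω) (p q : ℝ≥0∞) (α : Set Ω) : Set (Lp ℝ p m × Lp ℝ q m) :=
  {x | (∀ᵐ ω ∂m, ω ∉ α → x.1 ω ≤ 0) ∧ ∀ᵐ ω ∂m, ω ∈ α → x.2 ω ≤ 0}

theorem coeFn_combo_Lp {p : ℝ≥0∞} (f g : Lp ℝ p m) (a b : ℝ) :
    (a • f + b • g : Lp ℝ p m) =ᵐ[m] fun ω => a * f ω + b * g ω := by
  filter_upwards [Lp.coeFn_add (a • f) (b • g), Lp.coeFn_smul a f, Lp.coeFn_smul b g]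
    with ω h1 h2 h3
  rw [h1, Pi.add_apply, h2, h3, Pi.smul_apply, Pi.smul_apply, smul_eq_mul, smul_eq_mul]

theorem convex_setOf_ae_le_Lp {p : ℝ≥0∞} [Fact (1 ≤ p)] (P : Ω → Prop) (c : Ω → ℝ) :
    Convex ℝ {f : Lp ℝ p m | ∀ᵐ ω ∂m, P ω → f ω ≤ c ω} := by
  intro f hf g hg a b ha hb hab
  filter_upwards [hf, hg, coeFn_combo_Lp f g a b] with ω h1 h2 h3 hP
  rw [h3]
  calc a * f ω + b * g ω ≤ a * c ω + b * c ω :=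
        add_le_add (mul_le_mul_of_nonneg_left (h1 hP) ha) (mul_le_mul_of_nonneg_left (h2 hP) hb)
    _ = c ω := by rw [← add_mul, hab, one_mul]

theorem convex_signSet {p q : ℝ≥0∞} [Fact (1 ≤ p)] [Fact (1 ≤ q)] (α : Set Ω) :
    Convex ℝ (signSet m p q α) :=
  ((convex_setOf_ae_le_Lp (· ∉ α) 0).linear_preimage (LinearMap.fst ℝ _ _)).inter
    ((convex_setOf_ae_le_Lp (· ∈ α) 0).linear_preimage (LinearMap.snd ℝ _ _))

/-- A small step from a point of `signSet m p q α` towards a point of `signSet m p q β` stays in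
`signSet m p q α` if, where `α` and `β` differ, the component of `x` whose sign is at stake is
below `-δ` and the upper bound `c₀` for the components of `y` is at most `M`. The step length
`δ / (M + δ)` depends on `δ` and `M` only. -/
theorem smul_add_smul_mem_signSet {p q : ℝ≥0∞} [Fact (1 ≤ p)] [Fact (1 ≤ q)] {α β : Set Ω}
    {c₀ : Ω → ℝ} {M δ : ℝ} (hM : 0 ≤ M) (hδ : 0 < δ) {x y : Lp ℝ p m × Lp ℝ q m}
    (hx : x ∈ signSet m p q α) (hy : y ∈ signSet m p q β)
    (hy₁ : ∀ᵐ ω ∂m, y.1 ω ≤ c₀ ω) (hy₂ : ∀ᵐ ω ∂m, y.2 ω ≤ c₀ ω)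
    (hβα : ∀ᵐ ω ∂m, ω ∈ β → ω ∉ α → x.1 ω < -δ ∧ c₀ ω ≤ M)
    (hαβ : ∀ᵐ ω ∂m, ω ∈ α → ω ∉ β → x.2 ω < -δ ∧ c₀ ω ≤ M) :
    (M / (M + δ)) • x + (δ / (M + δ)) • y ∈ signSet m p q α := by
  have hMδ : 0 < M + δ := by linarith
  have ha : 0 ≤ M / (M + δ) := by positivity
  have hb : 0 ≤ δ / (M + δ) := by positivity
  -- on the symmetric difference the slack `-δ` of `x` absorbs the upper bound `M` of `y`
  have hmix : ∀ s r : ℝ, s < -δ → r ≤ M → M / (M + δ) * s + δ / (M + δ) * r ≤ 0 := by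
    intro s r hs hr
    calc _ ≤ M / (M + δ) * (-δ) + δ / (M + δ) * M :=
          add_le_add (mul_le_mul_of_nonneg_left hs.le ha) (mul_le_mul_of_nonneg_left hr hb)
      _ = 0 := by ring
  have hsame : ∀ s r : ℝ, s ≤ 0 → r ≤ 0 → M / (M + δ) * s + δ / (M + δ) * r ≤ 0 :=
    fun s r hs hr => add_nonpos (mul_nonpos_of_nonneg_of_nonpos ha hs)
      (mul_nonpos_of_nonneg_of_nonpos hb hr)
  constructor
  · filter_upwards [hx.1, hy.1, hy₁, hβα, coeFn_combo_Lp x.1 y.1 (M / (M + δ)) (δ / (M + δ))]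
      with ω h1 h2 h3 h4 h5 hω
    rw [Prod.fst_add, Prod.smul_fst, Prod.smul_fst, h5]
    by_cases hωβ : ω ∈ β
    · exact hmix _ _ (h4 hωβ hω).1 (h3.trans (h4 hωβ hω).2)
    · exact hsame _ _ (h1 hω) (h2 hωβ)
  · filter_upwards [hx.2, hy.2, hy₂, hαβ, coeFn_combo_Lp x.2 y.2 (M / (M + δ)) (δ / (M + δ))]
      with ω h1 h2 h3 h4 h5 hω
    rw [Prod.snd_add, Prod.smul_snd, Prod.smul_snd, h5]
    by_cases hωβ : ω ∈ β
    · exact hsame _ _ (h1 hω) (h2 hωβ)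
    · exact hmix _ _ (h4 hω hωβ).1 (h3.trans (h4 hω hωβ).2)

theorem exists_subseq_tendsto_ae_Lp {p : ℝ≥0∞} [Fact (1 ≤ p)] {f : ℕ → Lp ℝ p m} {g : Lp ℝ p m}
    (h : Tendsto f atTop (𝓝 g)) :
    ∃ φ : ℕ → ℕ, StrictMono φ ∧ ∀ᵐ ω ∂m, Tendsto (fun n => f (φ n) ω) atTop (𝓝 (g ω)) :=
  (tendstoInMeasure_of_tendsto_Lp h).exists_seq_tendsto_ae

theorem exists_subseq_tendsto_ae_prod_Lp {p q : ℝ≥0∞} [Fact (1 ≤ p)] [Fact (1 ≤ q)]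
    {x : ℕ → Lp ℝ p m × Lp ℝ q m} {z : Lp ℝ p m × Lp ℝ q m} (h : Tendsto x atTop (𝓝 z)) :
    ∃ φ : ℕ → ℕ, StrictMono φ ∧ ∀ᵐ ω ∂m, Tendsto (fun n => (x (φ n)).1 ω) atTop (𝓝 (z.1 ω)) ∧
      Tendsto (fun n => (x (φ n)).2 ω) atTop (𝓝 (z.2 ω)) := by
  obtain ⟨φ, hφ, h1⟩ := exists_subseq_tendsto_ae_Lp ((continuous_fst.tendsto z).comp h)
  obtain ⟨ψ, hψ, h2⟩ := exists_subseq_tendsto_ae_Lp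
    (((continuous_snd.tendsto z).comp h).comp hφ.tendsto_atTop)
  refine ⟨φ ∘ ψ, hφ.comp hψ, ?_⟩
  filter_upwards [h1, h2] with ω h3 h4
  exact ⟨h3.comp hψ.tendsto_atTop, h4⟩

/-- Where the limit `w` has `w.1 > 0`, almost every point lies in `α n` eventually along a
subsequence, whence `w.2 ≤ 0`; if `w.2 < 0`, then `hyα` applies eventually, and `y n → w` gives
`w.1 ≤ 0`. The other sign is symmetric, with `z` for `y`. -/
theorem complementary_of_tendsto {p q : ℝ≥0∞} [Fact (1 ≤ p)] [Fact (1 ≤ q)] {c₀ : Ω → ℝ}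
    {α : ℕ → Set Ω} {x y z : ℕ → Lp ℝ p m × Lp ℝ q m} {w : Lp ℝ p m × Lp ℝ q m}
    (hx : Tendsto x atTop (𝓝 w)) (hy : Tendsto y atTop (𝓝 w)) (hz : Tendsto z atTop (𝓝 w))
    {δ M : ℕ → ℝ} (hδ : Tendsto δ atTop (𝓝 0)) (hM : Tendsto M atTop atTop)
    (hxα : ∀ n, x n ∈ signSet m p q (α n))
    (hyα : ∀ n, ∀ᵐ ω ∂m, ω ∈ α n → (x n).2 ω < -δ n → c₀ ω ≤ M n → (y n).1 ω ≤ 0)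
    (hzα : ∀ n, ∀ᵐ ω ∂m, ω ∉ α n → (x n).1 ω < -δ n → c₀ ω ≤ M n → (z n).2 ω ≤ 0) :
    ∀ᵐ ω ∂m, (w.1 ω < 0 ∧ w.2 ω < 0) ∨ w.1 ω * w.2 ω = 0 := by
  obtain ⟨φ₁, hφ₁, h1⟩ := exists_subseq_tendsto_ae_prod_Lp hx
  obtain ⟨φ₂, hφ₂, h2⟩ := exists_subseq_tendsto_ae_prod_Lp (hy.comp hφ₁.tendsto_atTop)
  obtain ⟨φ₃, hφ₃, h3⟩ :=
    exists_subseq_tendsto_ae_prod_Lp (hz.comp (hφ₁.comp hφ₂).tendsto_atTop)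
  filter_upwards [h1, h2, h3, ae_all_iff.2 fun n => (hxα n).1, ae_all_iff.2 fun n => (hxα n).2,
    ae_all_iff.2 hyα, ae_all_iff.2 hzα] with ω t1 t2 t3 a1 a2 a3 a4
  set φ : ℕ → ℕ := fun n => φ₁ (φ₂ (φ₃ n)) with hφdef
  have hφ : Tendsto φ atTop atTop := ((hφ₁.comp hφ₂).comp hφ₃).tendsto_atTop
  have tx := fun {u : ℕ → ℝ} {l : Filter ℝ} (h : Tendsto u atTop l) =>
    h.comp (hφ₂.comp hφ₃).tendsto_atTop
  have tx1 : Tendsto (fun n => (x (φ n)).1 ω) atTop (𝓝 (w.1 ω)) := tx t1.1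
  have tx2 : Tendsto (fun n => (x (φ n)).2 ω) atTop (𝓝 (w.2 ω)) := tx t1.2
  have ty1 : Tendsto (fun n => (y (φ n)).1 ω) atTop (𝓝 (w.1 ω)) :=
    t2.1.comp hφ₃.tendsto_atTop
  have tz2 : Tendsto (fun n => (z (φ n)).2 ω) atTop (𝓝 (w.2 ω)) := t3.2
  have hMω : ∀ᶠ n in atTop, c₀ ω ≤ M (φ n) := (hM.comp hφ).eventually_ge_atTop _
  have hδω : Tendsto (fun n => -δ (φ n)) atTop (𝓝 0) := by simpa using (hδ.comp hφ).neg
  have pos1 : 0 < w.1 ω → w.2 ω = 0 := by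
    intro hpos
    have hmem : ∀ᶠ n in atTop, ω ∈ α (φ n) := by
      filter_upwards [tx1.eventually_const_lt hpos] with n hn
      by_contra hcon
      exact absurd (a1 _ hcon) (not_le.2 hn)
    have hle : w.2 ω ≤ 0 := le_of_tendsto tx2 (hmem.mono fun n hn => a2 _ hn)
    refine le_antisymm hle (not_lt.1 fun hneg => ?_)
    obtain ⟨n, n1, n2, n3, n4⟩ := (hmem.and ((tx2.eventually_lt hδω hneg).and
      (hMω.and (ty1.eventually_const_lt hpos)))).exists
    exact absurd (a3 _ n1 n2 n3) (not_le.2 n4)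
  have pos2 : 0 < w.2 ω → w.1 ω = 0 := by
    intro hpos
    have hmem : ∀ᶠ n in atTop, ω ∉ α (φ n) := by
      filter_upwards [tx2.eventually_const_lt hpos] with n hn hcon
      exact absurd (a2 _ hcon) (not_le.2 hn)
    have hle : w.1 ω ≤ 0 := le_of_tendsto tx1 (hmem.mono fun n hn => a1 _ hn)
    refine le_antisymm hle (not_lt.1 fun hneg => ?_)
    obtain ⟨n, n1, n2, n3, n4⟩ := (hmem.and ((tx1.eventually_lt hδω hneg).and
      (hMω.and (tz2.eventually_const_lt hpos)))).exists
    exact absurd (a4 _ n1 n2 n3) (not_le.2 n4)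
  rcases lt_trichotomy (w.1 ω) 0 with h | h | h
  · rcases lt_trichotomy (w.2 ω) 0 with h' | h' | h'
    · exact Or.inl ⟨h, h'⟩
    · exact Or.inr (by rw [h', mul_zero])
    · exact Or.inr (by rw [pos2 h', zero_mul])
  · exact Or.inr (by rw [h, zero_mul])
  · exact Or.inr (by rw [pos1 h, mul_zero])

end

/-! ### Complementary points of the closed convex hull -/

theorem mainTheorem1 {Ω : Type*} [MeasurableSpace Ω] (m : Measure Ω)
    (p q : ℝ≥0∞) [Fact (1 ≤ p)] [Fact (1 ≤ q)]
    (hp : 1 < p) (hp' : p < ∞) (hq : 1 < q) (hq' : q < ∞)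
    (μ : Set Ω → Lp ℝ p m) (ν : Set Ω → Lp ℝ q m)
    (hμ : ∀ α : Set Ω, MeasurableSet α → ∀ᵐ ω ∂m, ω ∉ α → μ α ω ≤ 0)
    (hν : ∀ α : Set Ω, MeasurableSet α → ∀ᵐ ω ∂m, ω ∈ α → ν α ω ≤ 0)
    (c₀ : Ω → ℝ) (hc₀ : Measurable c₀)
    (hle : ∀ α : Set Ω, MeasurableSet α → ∀ᵐ ω ∂m, max (μ α ω) (ν α ω) ≤ c₀ ω)
    (c₁ : ℝ) (hc₁ : 0 < c₁)
    (hnorm : ∀ α : Set Ω, MeasurableSet α → ‖μ α‖ + ‖ν α‖ ≤ c₁) :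
    ∃ (μbar : Lp ℝ p m) (νbar : Lp ℝ q m),
      (μbar, νbar) ∈ closedConvexHull ℝ
        {x : Lp ℝ p m × Lp ℝ q m | ∃ α : Set Ω, MeasurableSet α ∧ x = (μ α, ν α)} ∧
      ∀ᵐ ω ∂m, (μbar ω < 0 ∧ νbar ω < 0) ∨ μbar ω * νbar ω = 0 := by
  set S : Set (Lp ℝ p m × Lp ℝ q m) := {x | ∃ α : Set Ω, MeasurableSet α ∧ x = (μ α, ν α)}
    with hS
  set K₀ := convexHull ℝ S with hK₀def
  have hK₀ : Convex ℝ K₀ := convex_convexHull ℝ S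
  have : Nonempty {α : Set Ω // MeasurableSet α} := ⟨⟨∅, MeasurableSet.empty⟩⟩
  let C : {α : Set Ω // MeasurableSet α} → Set (Lp ℝ p m × Lp ℝ q m) := fun α =>
    signSet m p q α.1
  have hne : ∀ i, (C i ∩ K₀).Nonempty := fun i =>
    ⟨(μ i.1, ν i.1), ⟨hμ i.1 i.2, hν i.1 i.2⟩, subset_convexHull ℝ S ⟨i.1, i.2, rfl⟩⟩
  have hK₀c₀ : ∀ x ∈ K₀, (∀ᵐ ω ∂m, x.1 ω ≤ c₀ ω) ∧ ∀ᵐ ω ∂m, x.2 ω ≤ c₀ ω := by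
    have hconv : Convex ℝ {x : Lp ℝ p m × Lp ℝ q m |
        (∀ᵐ ω ∂m, True → x.1 ω ≤ c₀ ω) ∧ ∀ᵐ ω ∂m, True → x.2 ω ≤ c₀ ω} :=
      ((convex_setOf_ae_le_Lp (fun _ => True) c₀).linear_preimage (LinearMap.fst ℝ _ _)).inter
        ((convex_setOf_ae_le_Lp (fun _ => True) c₀).linear_preimage (LinearMap.snd ℝ _ _))
    intro x hx
    have := convexHull_min (s := S) (by
      rintro _ ⟨α, hα, rfl⟩
      exact ⟨(hle α hα).mono fun ω h _ => (le_max_left _ _).trans h,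
        (hle α hα).mono fun ω h _ => (le_max_right _ _).trans h⟩) hconv hx
    simpa using this
  have hR : ∀ x ∈ K₀, ‖x‖ ≤ c₁ := by
    intro x hx
    have := convexHull_min (s := S) (t := Metric.closedBall 0 c₁) (by
      rintro _ ⟨α, hα, rfl⟩
      have := hnorm α hα
      rw [mem_closedBall_zero_iff, Prod.norm_def]
      exact max_le (by linarith [norm_nonneg (ν α)]) (by linarith [norm_nonneg (μ α)]))
      (convex_closedBall 0 c₁) hx
    simpa using this
  have hp1 : 1 < p.toReal := one_lt_toReal_of_lt_top hp hp'
  have hq1 : 1 < q.toReal := one_lt_toReal_of_lt_top hq hq'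
  let Ψ : Lp ℝ p m × Lp ℝ q m → ℝ := fun x => ‖x.1‖ ^ p.toReal + ‖x.2‖ ^ q.toReal
  have hΨ : ConvexOn ℝ Set.univ Ψ := by
    have h : ∀ {F : Type _} [NormedAddCommGroup F] [NormedSpace ℝ F] {r : ℝ}, 1 < r →
        ConvexOn ℝ Set.univ fun f : F => ‖f‖ ^ r := fun {F _ _ r} hr =>
      ⟨convex_univ, fun f _ g _ a b ha hb hab => by
        have hr0 : 0 ≤ r := by linarith
        calc ‖a • f + b • g‖ ^ r ≤ (a • ‖f‖ + b • ‖g‖) ^ r :=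
              Real.rpow_le_rpow (norm_nonneg _)
                ((convexOn_univ_norm (E := F)).2 trivial trivial ha hb hab) hr0
          _ ≤ _ := (convexOn_rpow hr.le).2 (norm_nonneg f) (norm_nonneg g) ha hb hab⟩
    exact ((h hp1).comp_linearMap (LinearMap.fst ℝ _ _)).add
      ((h hq1).comp_linearMap (LinearMap.snd ℝ _ _))
  have hΨc : Continuous Ψ :=
    (continuous_fst.norm.rpow_const fun _ => Or.inr (by linarith)).add
      (continuous_snd.norm.rpow_const fun _ => Or.inr (by linarith))
  have hb : ∀ x ∈ K₀, |Ψ x| ≤ c₁ ^ p.toReal + c₁ ^ q.toReal := fun x hx => by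
    have h0 : 0 ≤ Ψ x := by positivity
    rw [abs_of_nonneg h0]
    exact add_le_add
      (Real.rpow_le_rpow (norm_nonneg _) ((norm_fst_le x).trans (hR x hx)) (by linarith))
      (Real.rpow_le_rpow (norm_nonneg _) ((norm_snd_le x).trans (hR x hx)) (by linarith))
  have huc : ∀ θ > 0, ∃ η > 0, ∀ x ∈ K₀, ∀ y ∈ K₀,
      Ψ x / 2 + Ψ y / 2 - Ψ ((1 / 2 : ℝ) • (x + y)) ≤ η → ‖x - y‖ ≤ θ := by
    intro θ hθ
    obtain ⟨η₁, hη₁, h1⟩ := exists_norm_sub_le_of_midpoint_gap_Lp (m := m) hp hp' c₁ hθ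
    obtain ⟨η₂, hη₂, h2⟩ := exists_norm_sub_le_of_midpoint_gap_Lp (m := m) hq hq' c₁ hθ
    refine ⟨min η₁ η₂, lt_min hη₁ hη₂, fun x hx y hy hgap => ?_⟩
    have g1 := norm_midpoint_rpow_le_Lp hp hp' x.1 y.1
    have g2 := norm_midpoint_rpow_le_Lp hq hq' x.2 y.2
    simp only [Ψ, Prod.smul_fst, Prod.smul_snd, Prod.fst_add, Prod.snd_add] at hgap
    have l1 := min_le_left η₁ η₂
    have l2 := min_le_right η₁ η₂
    rw [Prod.norm_def]
    exact max_le
      (h1 x.1 y.1 ((norm_fst_le x).trans (hR x hx)) ((norm_fst_le y).trans (hR y hy))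
        (by linarith))
      (h2 x.2 y.2 ((norm_snd_le x).trans (hR x hx)) ((norm_snd_le y).trans (hR y hy))
        (by linarith))
  -- `δ n → 0` and `M n → ∞`, so that the exceptional sets below exhaust the bad set; the diameters
  -- are small even when compared with the step length `t n` that goes with `δ n` and `M n`
  let δ : ℕ → ℝ := fun n => 1 / ((n : ℝ) + 1)
  let M : ℕ → ℝ := fun n => n
  have hδ : ∀ n, 0 < δ n := fun n => Nat.one_div_pos_of_nat
  have hM : ∀ n, 0 ≤ M n := fun n => n.cast_nonneg
  let t : ℕ → ℝ := fun n => δ n / (M n + δ n)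
  have ht : ∀ n, 0 < t n := fun n => div_pos (hδ n) (by linarith [hδ n, hM n])
  have ht1 : ∀ n, t n ≤ 1 := fun n =>
    div_le_one_of_le₀ (by linarith [hM n]) (by linarith [hδ n, hM n])
  obtain ⟨i, D, hDK, hDconv, hDne, hdiam, hlink⟩ := exists_seq_shrinking (C := C) hK₀
    (fun i => convex_signSet i.1) hne hΨ hΨc hR hb huc
    (θ := fun n => t n * (1 / 2) ^ n) (fun n => mul_pos (ht n) (by positivity))
  choose x hx using fun n => hDne n (i n)
  have hcauchy : CauchySeq x := cauchySeq_of_le_geometric (1 / 2) 1 (by norm_num) fun n => by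
    rw [dist_eq_norm, one_mul]
    exact (hlink n _ (hx n) _ (hx (n + 1))).trans
      (mul_le_of_le_one_left (by positivity) (ht1 n))
  obtain ⟨w, hw⟩ := cauchySeq_tendsto_of_complete hcauchy
  -- a step of length `t n` from `x n` towards `y n` moves by at most the diameter
  have close : ∀ y : ℕ → Lp ℝ p m × Lp ℝ q m,
      (∀ n, y n ∈ D n ∧ (M n / (M n + δ n)) • x n + (δ n / (M n + δ n)) • y n ∈ C (i n)) →
      Tendsto y atTop (𝓝 w) := by
    intro y hy
    have hn : ∀ n, ‖x n - y n‖ ≤ (1 / 2) ^ n := fun n => by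
      have hMδ : 0 < M n + δ n := by linarith [hδ n, hM n]
      have hmem := hDconv n (hx n).2 (hy n).1 (div_nonneg (hM n) hMδ.le)
        (div_nonneg (hδ n).le hMδ.le) (by rw [← add_div, div_self hMδ.ne'])
      refine (norm_sub_le_of_mix (hM n) (hδ n) (hdiam n _ (hx n) _ ⟨(hy n).2, hmem⟩)).trans
        (le_of_eq ?_)
      have := (hδ n).ne'
      simp only [t]
      field_simp
    have hz : Tendsto (fun n => x n - y n) atTop (𝓝 0) :=
      squeeze_zero_norm hn (tendsto_pow_atTop_nhds_zero_of_lt_one (by norm_num) (by norm_num))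
    simpa using hw.sub hz
  have hP : ∀ n, MeasurableSet ({ω | (x n).2 ω < -δ n} ∩ {ω | c₀ ω ≤ M n}) := fun n =>
    (measurableSet_lt (Lp.stronglyMeasurable _).measurable measurable_const).inter
      (measurableSet_le hc₀ measurable_const)
  have hQ : ∀ n, MeasurableSet ({ω | (x n).1 ω < -δ n} ∩ {ω | c₀ ω ≤ M n}) := fun n =>
    (measurableSet_lt (Lp.stronglyMeasurable _).measurable measurable_const).inter
      (measurableSet_le hc₀ measurable_const)
  -- `y` flips the part of `α` where the second component is negative, `z` the part of its complement
  -- where the first one is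
  choose y hy using fun n => hDne n ⟨_, (i n).2.diff (hP n)⟩
  choose z hz using fun n => hDne n ⟨_, (i n).2.union (hQ n)⟩
  have hyw : Tendsto y atTop (𝓝 w) := close y fun n => ⟨(hy n).2,
    smul_add_smul_mem_signSet (hM n) (hδ n) (hx n).1 (hy n).1 (hK₀c₀ _ (hDK n (hy n).2)).1
      (hK₀c₀ _ (hDK n (hy n).2)).2 (.of_forall fun ω h1 h2 => absurd h1.1 h2)
      (.of_forall fun ω h1 h2 => by
        by_contra hcon
        exact h2 ⟨h1, hcon⟩)⟩
  have hzw : Tendsto z atTop (𝓝 w) := close z fun n => ⟨(hz n).2,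
    smul_add_smul_mem_signSet (hM n) (hδ n) (hx n).1 (hz n).1 (hK₀c₀ _ (hDK n (hz n).2)).1
      (hK₀c₀ _ (hDK n (hz n).2)).2 (.of_forall fun ω h1 h2 => h1.resolve_left h2)
      (.of_forall fun ω h1 h2 => absurd (Or.inl h1) h2)⟩
  refine ⟨w.1, w.2, ?_, complementary_of_tendsto hw hyw hzw (c₀ := c₀) (δ := δ) (M := M)
    (α := fun n => (i n).1) tendsto_one_div_add_atTop_nhds_zero_nat tendsto_natCast_atTop_atTop
    (fun n => (hx n).1) (fun n => ?_) (fun n => ?_)⟩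
  · rw [closedConvexHull_eq_closure_convexHull]
    exact mem_closure_of_tendsto hw (.of_forall fun n => hDK n (hx n).2)
  · filter_upwards [(hy n).1.1] with ω h _ h2 h3
    exact h fun hcon => hcon.2 ⟨h2, h3⟩
  · filter_upwards [(hz n).1.2] with ω h _ h2 h3
    exact h (Or.inr ⟨h2, h3⟩)
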